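/- Let $\|\cdot\|$ be a norm on $\mathbf{R}^d$, let $V$ be a finite nonempty set of agents and $\epsilon>0$. In the mixed model the agents hold opinions $x_i(t)\in\mathbf{R}^d$, $i\in V$, $t=0,1,2,\dots$. At each time $t$ there is a social graph $G(t)=(V,E(t))$ (a simple graph) and, given the past up to and including $G(t)$, one edge $(i,j)\in E(t)$ is selected uniformly at random (if $E(t)$ is nonempty); then $$x_i(t+1)=x_i(t)+\mu(t)\,(x_j(t)-x_i(t))\,\mathbf 1\{\|x_i(t)-x_j(t)\|\le\epsilon\},$$ $$x_j(t+1)=x_j(t)+\mu(t)\,(x_i(t)-x_j(t))\,\mathbf 1\{\|x_i(t)-x_j(t)\|\le\epsilon\},$$ and all other opinions stay unchanged (all of them, if $E(t)=\varnothing$). Here $\mu(t)\in[0,1/2]$. The social graphs and the convergence parameters may be deterministic, or random and non-anticipating: $G(t)$ may depend on the past before the selection at time $t$, and $\mu(t)$ on this past and on the selected edge. Assume that the initial opinions $x_i(0)$, $i\in V$, are independent and identically distributed, distributed as a random variable $X$, with values almost surely in a bounded convex set $\Delta\subset\mathbf{R}^d$. Let $c$ be a Chebyshev center of $\Delta$,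 that is, a minimizer of $c'\mapsto\sup_{z\in\Delta}\|z-c'\|$ over $\mathbf{R}^d$ (it is unique for the Euclidean norm), and let $r=\sup_{z\in\Delta}\|z-c\|$. Assume that almost surely $G(t)$ is connected for infinitely many $t$, that almost surely $\inf_{t\ge0}\mu(t)>0$, and that $\epsilon>r$. Let $$\mathscr C=\Big\{\limsup_{t\to\infty}\max_{i,j\in V}\|x_i(t)-x_j(t)\|=0\Big\}$$ be the event of consensus. Then $$P(\mathscr C)\ \ge\ 1-\frac{\mathbf E\|X-c\|}{\epsilon-r},$$ a bound that does not depend on the number of agents. In particular, $P(\mathscr C)=1$ if $\epsilon\ge\operatorname{diam}(\Delta)$. -/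

import Mathlib

open MeasureTheory ProbabilityTheory Filter

section MixedModel

variable {V E Ω : Type*} [Fintype V] [NormedAddCommGroup E] [NormedSpace ℝ E]

open Classical in
/-- One step of the mixed model. If the selected edge is `e = s(i, j)`, if `i` and `j` are neighbours
in the social graph `G` and if their opinions are at distance at most `ε`, then `x i` becomes
`x i + μ (x j - x i)` and `x j` becomes `x j + μ (x i - x j)`; nothing else changes. For a given `i`
at most one summand is nonzero. If `e` is not an edge of `G`, nothing happens (this
matters only if `G` has no edge, so that no pair can be selected). -/
noncomputable def mixedStep (ε : ℝ) (G : SimpleGraph V) (e : Sym2 V) (μ : ℝ) (x : V → E) : V → E :=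
  fun i => x i + ∑ j, if s(i, j) = e ∧ G.Adj i j ∧ ‖x i - x j‖ ≤ ε then μ • (x j - x i) else 0

/-- The opinions `opinion ε G sel μ x₀ t i` of agent `i` at time `t`, for given social graphs `G t`,
selected edges `sel t`, convergence parameters `μ t` and initial opinions `x₀`. -/
noncomputable def opinion (ε : ℝ) (G : ℕ → SimpleGraph V) (sel : ℕ → Sym2 V) (μ : ℕ → ℝ)
    (x₀ : V → E) : ℕ → V → E
  | 0 => x₀
  | t + 1 => mixedStep ε (G t) (sel t) (μ t) (opinion ε G sel μ x₀ t)

/-- The trajectory `x` leads to a consensus: `limsup_{t → ∞} max_{i, j} ‖x_i(t) - x_j(t)‖ = 0`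
(computed in `[0, ∞]`). -/
def IsConsensus (x : ℕ → V → E) : Prop :=
  limsup (fun t => ⨆ i, ⨆ j, ‖x t i - x t j‖ₑ) atTop = 0

/-- The radius of `Δ` as seen from `c`: `sup_{z ∈ Δ} ‖z - c‖` (for bounded nonempty `Δ`). -/
noncomputable def radiusAt (Δ : Set E) (c : E) : ℝ :=
  ⨆ z : Δ, ‖(z : E) - c‖

/-- `c` is a Chebyshev center of `Δ`: it minimizes `sup_{z ∈ Δ} ‖z - c‖` over the whole space. -/
def IsChebyshevCenter (Δ : Set E) (c : E) : Prop :=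
  ∀ c' : E, radiusAt Δ c ≤ radiusAt Δ c'

/-- The random inputs of the mixed model. `ℱ t` is the information available just before the
selection at time `t`. Initial opinions `x₀`, social graphs `G t`, selected
edges `sel t` and convergence parameters `μ t` are random; the social graph at time `t` may depend
on the past, and the convergence parameter also on the selected edge (deterministic `G`
and `μ` are a special case). Given the past, the selected edge is uniformly distributed on the
edges of `G t`, if there are any. -/
structure IsMixedModel [MeasurableSpace E] {mΩ : MeasurableSpace Ω} (P : Measure Ω)
    (ℱ : Filtration ℕ mΩ) (G : ℕ → Ω → SimpleGraph V) (sel : ℕ → Ω → Sym2 V) (μ : ℕ → Ω → ℝ)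
    (x₀ : V → Ω → E) : Prop where
  measurable_init : ∀ i, Measurable[ℱ 0] (x₀ i)
  measurable_graph : ∀ t i j, MeasurableSet[ℱ t] {ω | (G t ω).Adj i j}
  measurable_sel : ∀ t e, MeasurableSet[ℱ (t + 1)] {ω | sel t ω = e}
  measurable_rate : ∀ t, Measurable[ℱ (t + 1)] (μ t)
  rate_mem : ∀ t ω, μ t ω ∈ Set.Icc (0 : ℝ) (1 / 2)
  uniform_sel : ∀ t e, ∀ᵐ ω ∂P, (G t ω).edgeSet.Nonempty →
    (P[({ω' | sel t ω' = e}).indicator (fun _ => (1 : ℝ)) | ℱ t]) ω =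
      ((G t ω).edgeSet.indicator (fun _ => ((G t ω).edgeSet.ncard : ℝ)⁻¹)) e

end MixedModel

/-! ### One step: convexity and quadratic energy. -/

section Deterministic

variable {V E : Type*} [Fintype V] [NormedAddCommGroup E] [NormedSpace ℝ E]

/-! An update averages two opinions symmetrically, so convex sets are invariant and sums of convex
functions of the opinions never increase. For a Euclidean squared norm the drop is quantitative
(`sum_norm_sq_mixedStep_le`); as `inf μ > 0`, distances across effective interactions tend to 0. By
conditional Borel–Cantelli, an edge whose length lies in `[δ, ε]` infinitely often would be selected
infinitely often in that state; hence almost surely all edges are eventually shorter than `δ` or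
longer than `ε`. At a late connected time, without near-agreement, each agent is almost `ε` away
from some other agent, who is within `r` of `c`; so each is almost `ε - r` away from `c`. Since the
sum of the distances to `c` never increases, this is impossible if that sum starts below `n (ε -
r)`, and Markov's inequality bounds the exceptional probability. -/

theorem mixedStep_left (ε : ℝ) {G : SimpleGraph V} (μ : ℝ) {x : V → E} {i j : V}
    (hadj : G.Adj i j) (hle : ‖x i - x j‖ ≤ ε) :
    mixedStep ε G s(i, j) μ x i = x i + μ • (x j - x i) := by
  classical
  rw [mixedStep, Finset.sum_eq_single j, if_pos ⟨rfl, hadj, hle⟩]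
  · intro k _ hk
    rw [if_neg]
    rintro ⟨h, -⟩
    exact hk (Sym2.congr_right.1 h)
  · simp

theorem mixedStep_eq_self_or (ε : ℝ) (G : SimpleGraph V) (e : Sym2 V) (μ : ℝ) (x : V → E) :
    mixedStep ε G e μ x = x ∨ ∃ i j, i ≠ j ∧ e = s(i, j) ∧
      mixedStep ε G e μ x i = x i + μ • (x j - x i) ∧
      mixedStep ε G e μ x j = x j + μ • (x i - x j) ∧
      ∀ k, k ≠ i → k ≠ j → mixedStep ε G e μ x k = x k := by
  classical
  by_cases h : ∃ i j, e = s(i, j) ∧ G.Adj i j ∧ ‖x i - x j‖ ≤ ε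
  · right
    obtain ⟨i, j, rfl, hadj, hle⟩ := h
    refine ⟨i, j, hadj.ne, rfl, mixedStep_left ε μ hadj hle, ?_, ?_⟩
    · rw [Sym2.eq_swap]
      exact mixedStep_left ε μ hadj.symm (by rwa [norm_sub_rev])
    · intro k hi hj
      rw [mixedStep, Finset.sum_eq_zero, add_zero]
      intro l _
      rw [if_neg]
      rintro ⟨h, -⟩
      have : k ∈ s(i, j) := h ▸ Sym2.mem_mk_left k l
      rcases Sym2.mem_iff.1 this with h | h
      · exact hi h
      · exact hj h
  · left
    funext i
    rw [mixedStep, Finset.sum_eq_zero, add_zero]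
    intro j _
    rw [if_neg]
    rintro ⟨h1, h2, h3⟩
    exact h ⟨i, j, h1.symm, h2, h3⟩

theorem mixedStep_mem {C : Set E} (hC : Convex ℝ C) (ε : ℝ) (G : SimpleGraph V) (e : Sym2 V)
    {μ : ℝ} (hμ : μ ∈ Set.Icc (0 : ℝ) (1 / 2)) {x : V → E} (hx : ∀ i, x i ∈ C) (i : V) :
    mixedStep ε G e μ x i ∈ C := by
  have hμ' : μ ∈ Set.Icc (0 : ℝ) 1 := ⟨hμ.1, hμ.2.trans (by norm_num)⟩
  rcases mixedStep_eq_self_or ε G e μ x with h | ⟨a, b, -, -, ha, hb, h⟩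
  · rw [h]
    exact hx i
  · by_cases hia : i = a
    · subst hia
      rw [ha]
      exact hC.add_smul_sub_mem (hx i) (hx b) hμ'
    · by_cases hib : i = b
      · subst hib
        rw [hb]
        exact hC.add_smul_sub_mem (hx i) (hx a) hμ'
      · rw [h i hia hib]
        exact hx i

theorem sum_eq_add_add_sum_erase [DecidableEq V] {i j : V} (hij : i ≠ j) (f : V → ℝ) :
    ∑ k, f k = f i + f j + ∑ k ∈ (Finset.univ.erase i).erase j, f k := by
  rw [← Finset.add_sum_erase Finset.univ f (Finset.mem_univ i),
    ← Finset.add_sum_erase (Finset.univ.erase i) f (by simp [hij.symm] : j ∈ _), add_assoc]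

/-- The sum of a convex function over all opinions does not increase. -/
theorem sum_mixedStep_le {f : E → ℝ} (hf : ConvexOn ℝ Set.univ f) (ε : ℝ) (G : SimpleGraph V)
    (e : Sym2 V) {μ : ℝ} (hμ : μ ∈ Set.Icc (0 : ℝ) (1 / 2)) (x : V → E) :
    ∑ k, f (mixedStep ε G e μ x k) ≤ ∑ k, f (x k) := by
  classical
  rcases mixedStep_eq_self_or ε G e μ x with h | ⟨i, j, hij, -, hi, hj, h⟩
  · rw [h]
  · have key : ∀ a b : E, f (a + μ • (b - a)) ≤ (1 - μ) * f a + μ * f b := by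
      intro a b
      have := hf.2 (Set.mem_univ a) (Set.mem_univ b) (by linarith [hμ.2] : 0 ≤ 1 - μ) hμ.1 (by ring)
      have e : a + μ • (b - a) = (1 - μ) • a + μ • b := by module
      rw [e]
      simpa using this
    rw [sum_eq_add_add_sum_erase hij, sum_eq_add_add_sum_erase hij (fun k => f (x k)), hi, hj]
    have hrest : ∑ k ∈ (Finset.univ.erase i).erase j, f (mixedStep ε G e μ x k) =
        ∑ k ∈ (Finset.univ.erase i).erase j, f (x k) := by
      refine Finset.sum_congr rfl fun k hk => ?_
      simp only [Finset.mem_erase, Finset.mem_univ, and_true] at hk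
      rw [h k hk.2 hk.1]
    linarith [key (x i) (x j), key (x j) (x i)]

theorem norm_sq_add_norm_sq_mix {F : Type*} [NormedAddCommGroup F] [InnerProductSpace ℝ F]
    (μ : ℝ) (a b : F) :
    ‖a + μ • (b - a)‖ ^ 2 + ‖b + μ • (a - b)‖ ^ 2 =
      ‖a‖ ^ 2 + ‖b‖ ^ 2 - 2 * (μ * (1 - μ)) * ‖a - b‖ ^ 2 := by
  simp only [← real_inner_self_eq_norm_sq, inner_add_left, inner_add_right, inner_sub_left,
    inner_sub_right, real_inner_smul_left, real_inner_smul_right, real_inner_comm a b]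
  ring

/-- The quadratic energy drops by a definite amount when compatible neighbours interact. -/
theorem sum_norm_sq_mixedStep_le {F : Type*} [NormedAddCommGroup F] [InnerProductSpace ℝ F]
    (L : E →ₗ[ℝ] F) {ε : ℝ} {G : SimpleGraph V} {μ : ℝ} (hμ : μ ∈ Set.Icc (0 : ℝ) (1 / 2))
    {x : V → E} {i j : V} (hadj : G.Adj i j) (hle : ‖x i - x j‖ ≤ ε) :
    ∑ k, ‖L (mixedStep ε G s(i, j) μ x k)‖ ^ 2 + μ * ‖L (x i - x j)‖ ^ 2 ≤
      ∑ k, ‖L (x k)‖ ^ 2 := by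
  classical
  have hi := mixedStep_left ε μ hadj hle
  have hj := mixedStep_left (x := x) ε μ hadj.symm (by rwa [norm_sub_rev])
  rw [Sym2.eq_swap] at hj
  rw [sum_eq_add_add_sum_erase hadj.ne,
    sum_eq_add_add_sum_erase hadj.ne (fun k => ‖L (x k)‖ ^ 2), hi, hj]
  have hrest : ∑ k ∈ (Finset.univ.erase i).erase j, ‖L (mixedStep ε G s(i, j) μ x k)‖ ^ 2 =
      ∑ k ∈ (Finset.univ.erase i).erase j, ‖L (x k)‖ ^ 2 := by
    refine Finset.sum_congr rfl fun k hk => ?_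
    simp only [Finset.mem_erase, Finset.mem_univ, and_true] at hk
    rcases mixedStep_eq_self_or ε G s(i, j) μ x with h | ⟨a, b, -, hab, -, -, h⟩
    · rw [h]
    · have : k ≠ a ∧ k ≠ b := by
        rcases Sym2.eq_iff.1 hab with ⟨rfl, rfl⟩ | ⟨rfl, rfl⟩
        · exact ⟨hk.2, hk.1⟩
        · exact ⟨hk.1, hk.2⟩
      rw [h k this.1 this.2]
  have hmix := norm_sq_add_norm_sq_mix μ (L (x i)) (L (x j))
  simp only [map_add, map_sub, map_smul]
  -- Since `μ ≤ 1/2`, the exact drop factor `2μ(1 - μ)` is at least `μ`.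
  nlinarith [mul_nonneg (mul_nonneg hμ.1 (by linarith [hμ.2] : 0 ≤ 1 - 2 * μ))
    (sq_nonneg ‖L (x i) - L (x j)‖)]

/-! ### Trajectories: invariance and energy decay. -/

variable {ε : ℝ} {G : ℕ → SimpleGraph V} {sel : ℕ → Sym2 V} {μ : ℕ → ℝ} {x₀ : V → E}

theorem opinion_mem {C : Set E} (hC : Convex ℝ C) (hμ : ∀ t, μ t ∈ Set.Icc (0 : ℝ) (1 / 2))
    (s : ℕ) (hx : ∀ i, opinion ε G sel μ x₀ s i ∈ C) {t : ℕ} (hst : s ≤ t) (i : V) :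
    opinion ε G sel μ x₀ t i ∈ C := by
  induction t, hst using Nat.le_induction generalizing i with
  | base => exact hx i
  | succ t _ ih => exact mixedStep_mem hC ε _ _ (hμ t) ih i

theorem antitone_sum_opinion {f : E → ℝ} (hf : ConvexOn ℝ Set.univ f)
    (hμ : ∀ t, μ t ∈ Set.Icc (0 : ℝ) (1 / 2)) :
    Antitone fun t => ∑ k, f (opinion ε G sel μ x₀ t k) :=
  antitone_nat_of_succ_le fun t => sum_mixedStep_le hf ε _ _ (hμ t) _

/-- If all opinions are within distance `η` of each other, then they stay so. -/
theorem norm_opinion_sub_le (hμ : ∀ t, μ t ∈ Set.Icc (0 : ℝ) (1 / 2)) {η : ℝ} {s : ℕ}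
    (hs : ∀ i j, ‖opinion ε G sel μ x₀ s i - opinion ε G sel μ x₀ s j‖ ≤ η) {t : ℕ} (hst : s ≤ t)
    (i j : V) : ‖opinion ε G sel μ x₀ t i - opinion ε G sel μ x₀ t j‖ ≤ η := by
  -- Balls are trapping sets: first centred at an opinion at time `s`, then, by symmetry of the
  -- distance, at one at time `t`.
  have h1 : ∀ a b, opinion ε G sel μ x₀ t a ∈ Metric.closedBall (opinion ε G sel μ x₀ s b) η :=
    fun a b => opinion_mem (convex_closedBall _ _) hμ s
      (fun k => by simpa [dist_eq_norm] using hs k b) hst a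
  have h2 := opinion_mem (convex_closedBall (opinion ε G sel μ x₀ t j) η) hμ s
    (fun k => by rw [Metric.mem_closedBall_comm]; exact h1 j k) hst i
  simpa [dist_eq_norm] using h2

/-- The energy identity needs an inner product; `K` transfers its conclusion back to the given norm.
-/
theorem exists_linearMap_euclideanSpace_norm_le {E : Type*} [NormedAddCommGroup E]
    [NormedSpace ℝ E] [FiniteDimensional ℝ E] :
    ∃ (L : E →ₗ[ℝ] EuclideanSpace ℝ (Fin (Module.finrank ℝ E))) (K : ℝ), 0 < K ∧
      ∀ v : E, ‖v‖ ≤ K * ‖L v‖ := by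
  let e : E ≃L[ℝ] EuclideanSpace ℝ (Fin (Module.finrank ℝ E)) := toEuclidean
  let f : EuclideanSpace ℝ (Fin (Module.finrank ℝ E)) →L[ℝ] E := e.symm
  refine ⟨e.toLinearMap, ‖f‖ + 1, by positivity, fun v => ?_⟩
  have h : ‖v‖ ≤ ‖f‖ * ‖e v‖ := by
    simpa [f] using f.le_opNorm (e v)
  change ‖v‖ ≤ (‖f‖ + 1) * ‖e v‖
  linarith [norm_nonneg (e v)]

/-- The distance of interacting agents tends to zero. -/
theorem eventually_selected_lt [FiniteDimensional ℝ E]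
    (hμ : ∀ t, μ t ∈ Set.Icc (0 : ℝ) (1 / 2)) (hpos : 0 < ⨅ t, μ t) {δ : ℝ} (hδ : 0 < δ) :
    ∀ᶠ t in atTop, ∀ i j, sel t = s(i, j) → (G t).Adj i j →
      ‖opinion ε G sel μ x₀ t i - opinion ε G sel μ x₀ t j‖ ≤ ε →
      ‖opinion ε G sel μ x₀ t i - opinion ε G sel μ x₀ t j‖ < δ := by
  obtain ⟨L, K, hK, hL⟩ := exists_linearMap_euclideanSpace_norm_le (E := E)
  set x := opinion ε G sel μ x₀ with hx
  let Φ : ℕ → ℝ := fun t => ∑ k, ‖L (x t k)‖ ^ 2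
  have hconv : ConvexOn ℝ Set.univ fun v : E => ‖L v‖ ^ 2 := by
    have h := (convexOn_univ_norm (E := EuclideanSpace ℝ (Fin (Module.finrank ℝ E)))).pow
      (fun _ _ => norm_nonneg _) 2
    exact h.comp_linearMap L
  have hanti : Antitone Φ := antitone_sum_opinion hconv hμ
  have hbdd : BddBelow (Set.range Φ) :=
    ⟨0, by rintro _ ⟨t, rfl⟩; exact Finset.sum_nonneg fun k _ => by positivity⟩
  have hlim := tendsto_atTop_ciInf hanti hbdd
  have hdiff : Tendsto (fun t => Φ t - Φ (t + 1)) atTop (nhds 0) := by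
    simpa using hlim.sub (hlim.comp (tendsto_add_atTop_nat 1))
  have hm : ∀ t, ⨅ t, μ t ≤ μ t :=
    fun t => ciInf_le ⟨0, by rintro _ ⟨t, rfl⟩; exact (hμ t).1⟩ t
  filter_upwards [hdiff.eventually (gt_mem_nhds
    (by positivity : 0 < (⨅ t, μ t) * (δ / K) ^ 2))] with t ht i j hsel hadj hle
  by_contra! hlt
  have hstep := sum_norm_sq_mixedStep_le L (hμ t) hadj hle
  rw [← hsel] at hstep
  change Φ (t + 1) + μ t * ‖L (x t i - x t j)‖ ^ 2 ≤ Φ t at hstep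
  have h1 : δ / K ≤ ‖L (x t i - x t j)‖ := by
    rw [div_le_iff₀ hK, mul_comm]
    exact hlt.trans (hL _)
  have h2 : (⨅ t, μ t) * (δ / K) ^ 2 ≤ μ t * ‖L (x t i - x t j)‖ ^ 2 := by
    have := (hμ t).1
    have := hm t
    gcongr
  linarith

/-! ### Connected times and consensus. -/

/-- Short edges cost at most `δ` each; the far end of the first incompatible edge serves as `k`. -/
theorem walk_norm_sub_le_or {V E : Type*} [NormedAddCommGroup E] {G : SimpleGraph V} {x : V → E} {δ ε : ℝ}
    (h : ∀ i j, G.Adj i j → ‖x i - x j‖ ≤ δ ∨ ε < ‖x i - x j‖) (hδ : 0 ≤ δ) {i j : V}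
    (p : G.Walk i j) :
    ‖x i - x j‖ ≤ p.length * δ ∨ ∃ k, ε - p.length * δ < ‖x i - x k‖ := by
  induction p with
  | nil => simp
  | @cons u v w huv p ih =>
    simp only [SimpleGraph.Walk.length_cons, Nat.cast_add, Nat.cast_one]
    have hp : 0 ≤ p.length * δ := by positivity
    rcases h u v huv with h1 | h1
    · rcases ih with h2 | ⟨k, h2⟩
      · left
        linarith [norm_sub_le_norm_sub_add_norm_sub (x u) (x v) (x w)]
      · right
        refine ⟨k, ?_⟩
        have := norm_sub_le_norm_sub_add_norm_sub (x v) (x u) (x k)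
        rw [norm_sub_rev (x v) (x u)] at this
        linarith
    · exact Or.inr ⟨v, by linarith⟩

/-- On a connected graph whose edges are either short or incompatible, an agent agrees with everyone
up to a small error or is far from some agent. -/
theorem forall_norm_sub_le_or_exists_lt {E : Type*} [NormedAddCommGroup E] {G : SimpleGraph V} (hG : G.Connected) {x : V → E}
    {δ ε : ℝ} (hδ : 0 ≤ δ) (h : ∀ i j, G.Adj i j → ‖x i - x j‖ ≤ δ ∨ ε < ‖x i - x j‖) (i : V) :
    (∀ j, ‖x i - x j‖ ≤ Fintype.card V * δ) ∨ ∃ k, ε - Fintype.card V * δ < ‖x i - x k‖ := by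
  by_contra! hcon
  obtain ⟨⟨j, hj⟩, hk⟩ := hcon
  obtain ⟨p, hp⟩ := hG.exists_isPath i j
  have hlen : (p.length : ℝ) * δ ≤ Fintype.card V * δ := by
    have : (p.length : ℝ) ≤ Fintype.card V := by exact_mod_cast hp.length_lt.le
    gcongr
  rcases walk_norm_sub_le_or h hδ p with h1 | ⟨k, h1⟩
  · linarith
  · linarith [hk k]

theorem isConsensus_of_forall_eventually {V E : Type*} [NormedAddCommGroup E] {x : ℕ → V → E}
    (h : ∀ η : ℝ, 0 < η → ∀ᶠ t in atTop, ∀ i j, ‖x t i - x t j‖ ≤ η) : IsConsensus x := by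
  refine Tendsto.limsup_eq (ENNReal.tendsto_nhds_zero.2 fun η hη => ?_)
  obtain ⟨η', hη', hlt⟩ := ENNReal.lt_iff_exists_nnreal_btwn.1 hη
  filter_upwards [h η' (by exact_mod_cast hη')] with t ht
  refine iSup_le fun i => iSup_le fun j => le_trans ?_ hlt.le
  rw [← ofReal_norm]
  simpa using ENNReal.ofReal_le_ofReal (ht i j)

/-- Near-agreement persists, so one good time per tolerance suffices. -/
theorem isConsensus_opinion (hμ : ∀ t, μ t ∈ Set.Icc (0 : ℝ) (1 / 2))
    (h : ∀ η : ℝ, 0 < η → ∃ t, ∀ i j,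
      ‖opinion ε G sel μ x₀ t i - opinion ε G sel μ x₀ t j‖ ≤ η) :
    IsConsensus (opinion ε G sel μ x₀) := by
  refine isConsensus_of_forall_eventually fun η hη => ?_
  obtain ⟨s, hs⟩ := h η hη
  filter_upwards [eventually_ge_atTop s] with t ht i j
  exact norm_opinion_sub_le hμ hs ht i j

theorem isConsensus_of_forall_le (hμ : ∀ t, μ t ∈ Set.Icc (0 : ℝ) (1 / 2))
    (hG : ∃ᶠ t in atTop, (G t).Connected)
    (hedge : ∀ δ : ℝ, 0 < δ → ∀ᶠ t in atTop, ∀ i j, (G t).Adj i j →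
      ‖opinion ε G sel μ x₀ t i - opinion ε G sel μ x₀ t j‖ < δ ∨
      ε < ‖opinion ε G sel μ x₀ t i - opinion ε G sel μ x₀ t j‖)
    (hle : ∀ i j, ‖x₀ i - x₀ j‖ ≤ ε) :
    IsConsensus (opinion ε G sel μ x₀) := by
  refine isConsensus_opinion hμ fun η hη => ?_
  rcases isEmpty_or_nonempty V with hV | hV
  · exact ⟨0, fun i => hV.elim i⟩
  have hn : (0 : ℝ) < Fintype.card V := by exact_mod_cast Fintype.card_pos
  obtain ⟨t, hGt, ht⟩ := (hG.and_eventually (hedge (η / Fintype.card V) (by positivity))).exists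
  refine ⟨t, fun i j => ?_⟩
  have h0 : ∀ i j, ‖opinion ε G sel μ x₀ t i - opinion ε G sel μ x₀ t j‖ ≤ ε :=
    norm_opinion_sub_le hμ (s := 0) hle (Nat.zero_le t)
  have hcancel : Fintype.card V * (η / Fintype.card V) = η := by field_simp
  -- All edges are short here, so the threshold is free; `ε + η` makes the second alternative exceed
  -- the bound `ε` on all distances.
  rcases forall_norm_sub_le_or_exists_lt (ε := ε + η) hGt (by positivity)
    (fun i j hij => Or.inl ((ht i j hij).resolve_right (h0 i j).not_gt).le) i with h | ⟨k, h⟩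
  · exact (h j).trans hcancel.le
  · rw [hcancel] at h
    linarith [h0 i k]

/-- If the initial opinions are close to `c` on average, then there is a consensus. -/
theorem isConsensus_of_sum_lt (hμ : ∀ t, μ t ∈ Set.Icc (0 : ℝ) (1 / 2))
    (hG : ∃ᶠ t in atTop, (G t).Connected)
    (hedge : ∀ δ : ℝ, 0 < δ → ∀ᶠ t in atTop, ∀ i j, (G t).Adj i j →
      ‖opinion ε G sel μ x₀ t i - opinion ε G sel μ x₀ t j‖ < δ ∨
      ε < ‖opinion ε G sel μ x₀ t i - opinion ε G sel μ x₀ t j‖)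
    {c : E} {r : ℝ} (hr : ∀ i, ‖x₀ i - c‖ ≤ r)
    (hsum : ∑ i, ‖x₀ i - c‖ < Fintype.card V * (ε - r)) :
    IsConsensus (opinion ε G sel μ x₀) := by
  refine isConsensus_opinion hμ fun η hη => ?_
  rcases isEmpty_or_nonempty V with hV | hV
  · exact ⟨0, fun i => hV.elim i⟩
  set n : ℝ := (Fintype.card V : ℝ) with hn_def
  have hn : 0 < n := by
    rw [hn_def]
    exact_mod_cast Fintype.card_pos
  set x := opinion ε G sel μ x₀ with hx
  -- `η / 2` lets two agents be compared through a third; the other term is the slack in `hsum` per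
  -- agent.
  set κ := min (η / 2) ((n * (ε - r) - ∑ i, ‖x₀ i - c‖) / n) with hκ
  have hκpos : 0 < κ := lt_min (by positivity) (div_pos (by linarith) hn)
  obtain ⟨t, hGt, ht⟩ := (hG.and_eventually (hedge (κ / n) (by positivity))).exists
  refine ⟨t, ?_⟩
  by_contra! hcon
  obtain ⟨a, b, hab⟩ := hcon
  have hcancel : n * (κ / n) = κ := by field_simp
  have hball : ∀ k, ‖x t k - c‖ ≤ r := fun k => by
    have := opinion_mem (ε := ε) (G := G) (sel := sel) (x₀ := x₀) (convex_closedBall c r) hμ 0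
      (fun i => by simpa [dist_eq_norm, opinion] using hr i) (Nat.zero_le t) k
    simpa [dist_eq_norm] using this
  -- An agent within `κ` of everyone would put `a` and `b` within `η`.
  have hfar : ∀ i, ε - r - κ < ‖x t i - c‖ := by
    intro i
    rcases forall_norm_sub_le_or_exists_lt hGt (by positivity)
      (fun i j hij => (ht i j hij).imp_left le_of_lt) i with h | ⟨k, h⟩
    · rw [← hn_def, hcancel] at h
      have h1 := norm_sub_le_norm_sub_add_norm_sub (x t a) (x t i) (x t b)
      rw [norm_sub_rev (x t a) (x t i)] at h1
      linarith [h a, h b, min_le_left (η / 2) ((n * (ε - r) - ∑ i, ‖x₀ i - c‖) / n)]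
    · rw [← hn_def, hcancel] at h
      have h1 := norm_sub_le_norm_sub_add_norm_sub (x t i) c (x t k)
      rw [norm_sub_rev c] at h1
      linarith [hball k]
  have hconv : ConvexOn ℝ Set.univ fun v : E => ‖v - c‖ := by
    simpa [dist_eq_norm] using convexOn_univ_dist (E := E) c
  have hZ : ∑ i, ‖x t i - c‖ ≤ ∑ i, ‖x₀ i - c‖ :=
    antitone_sum_opinion (ε := ε) (G := G) (sel := sel) (x₀ := x₀) hconv hμ (Nat.zero_le t)
  have hlow : n * (ε - r - κ) < ∑ i, ‖x t i - c‖ := by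
    have := Finset.sum_lt_sum_of_nonempty (s := Finset.univ) Finset.univ_nonempty
      fun i _ => hfar i
    rwa [Finset.sum_const, nsmul_eq_mul, Finset.card_univ] at this
  have hκ2 : n * κ ≤ n * (ε - r) - ∑ i, ‖x₀ i - c‖ := by
    have := min_le_right (η / 2) ((n * (ε - r) - ∑ i, ‖x₀ i - c‖) / n)
    rw [← hκ, le_div_iff₀ hn] at this
    linarith
  nlinarith

end Deterministic

/-! ### Measurability and conditional Borel–Cantelli. -/

section Random

variable {V E Ω : Type*} [Fintype V] [NormedAddCommGroup E] [NormedSpace ℝ E]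
  [MeasurableSpace E] [BorelSpace E]

theorem measurable_mixedStep [SecondCountableTopology E] [MeasurableSpace Ω] (ε : ℝ)
    {G : Ω → SimpleGraph V} {sel : Ω → Sym2 V} {μ : Ω → ℝ} {x : V → Ω → E}
    (hG : ∀ i j, MeasurableSet {ω | (G ω).Adj i j})
    (hsel : ∀ e, MeasurableSet {ω | sel ω = e}) (hμ : Measurable μ) (hx : ∀ i, Measurable (x i))
    (i : V) :
    Measurable fun ω => mixedStep ε (G ω) (sel ω) (μ ω) (fun k => x k ω) i := by
  unfold mixedStep
  refine (hx i).add (Finset.measurable_sum _ fun j _ => Measurable.ite ?_ ?_ measurable_const)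
  · have h1 : MeasurableSet {ω | s(i, j) = sel ω} := by
      simpa only [eq_comm] using hsel s(i, j)
    exact h1.inter ((hG i j).inter (measurableSet_le ((hx i).sub (hx j)).norm measurable_const))
  · exact hμ.smul ((hx j).sub (hx i))

theorem measurableSet_norm_sub_mem {E : Type*} [NormedAddCommGroup E] [MeasurableSpace E]
    [BorelSpace E] [SecondCountableTopology E] {mΩ : MeasurableSpace Ω} {f g : Ω → E}
    (hf : Measurable f) (hg : Measurable g) {s : Set ℝ} (hs : MeasurableSet s) :
    MeasurableSet {ω | ‖f ω - g ω‖ ∈ s} :=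
  (hf.sub hg).norm hs

variable {mΩ : MeasurableSpace Ω} {P : Measure Ω} {ℱ : Filtration ℕ mΩ}
  {G : ℕ → Ω → SimpleGraph V} {sel : ℕ → Ω → Sym2 V} {μ : ℕ → Ω → ℝ} {x₀ : V → Ω → E}

theorem IsMixedModel.measurable_opinion [SecondCountableTopology E]
    (h : IsMixedModel P ℱ G sel μ x₀) (ε : ℝ) (t : ℕ) (i : V) :
    Measurable[ℱ t] fun ω => opinion ε (fun t => G t ω) (fun t => sel t ω) (fun t => μ t ω)
      (fun i => x₀ i ω) t i := by
  induction t generalizing i with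
  | zero => exact h.measurable_init i
  | succ t ih =>
    exact @measurable_mixedStep V E Ω _ _ _ _ _ _ (ℱ (t + 1)) ε (G t) (sel t) (μ t)
      (fun i ω => opinion ε (fun t => G t ω) (fun t => sel t ω) (fun t => μ t ω)
        (fun i => x₀ i ω) t i)
      (fun i j => ℱ.mono t.le_succ _ (h.measurable_graph t i j)) (h.measurable_sel t)
      (h.measurable_rate t) (fun i => (ih i).mono (ℱ.mono t.le_succ) le_rfl) i

/-- An edge that satisfies a non-anticipating condition infinitely often is selected infinitely
often under that condition. -/
theorem IsMixedModel.ae_frequently_selected {E : Type*} [MeasurableSpace E] {x₀ : V → Ω → E}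
    [IsProbabilityMeasure P]
    (h : IsMixedModel P ℱ G sel μ x₀) (e : Sym2 V) {B : ℕ → Set Ω}
    (hB : ∀ t, MeasurableSet[ℱ t] (B t)) (hBe : ∀ t ω, ω ∈ B t → e ∈ (G t ω).edgeSet) :
    ∀ᵐ ω ∂P, (∃ᶠ t in atTop, ω ∈ B t) → ∃ᶠ t in atTop, sel t ω = e ∧ ω ∈ B t := by
  -- The shift is needed for adaptedness: the selection at time `k` is known only at `k + 1`.
  let S : ℕ → Set Ω := fun t => Nat.casesOn t ∅ fun k => B k ∩ {ω | sel k ω = e}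
  have hS : ∀ n, MeasurableSet[ℱ n] (S n) := by
    rintro (_ | n)
    · exact @MeasurableSet.empty _ (ℱ 0)
    · exact (ℱ.mono n.le_succ _ (hB n)).inter (h.measurable_sel n e)
  have hcond : ∀ t, ∀ᵐ ω ∂P, (P[(S (t + 1)).indicator (1 : Ω → ℝ) | ℱ t]) ω =
      (B t).indicator (fun ω => ((G t ω).edgeSet.ncard : ℝ)⁻¹) ω := by
    intro t
    have hselm : MeasurableSet {ω | sel t ω = e} := ℱ.le (t + 1) _ (h.measurable_sel t e)
    have hint : Integrable (({ω' | sel t ω' = e}).indicator (fun _ => (1 : ℝ))) P :=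
      (integrable_const 1).indicator hselm
    have hind : (S (t + 1)).indicator (1 : Ω → ℝ) =
        (B t).indicator (({ω' | sel t ω' = e}).indicator (fun _ => (1 : ℝ))) := by
      rw [Set.indicator_indicator]
      rfl
    rw [hind]
    filter_upwards [condExp_indicator hint (hB t), h.uniform_sel t e] with ω h1 h2
    rw [h1]
    by_cases hω : ω ∈ B t
    · rw [Set.indicator_of_mem hω, Set.indicator_of_mem hω, h2 ⟨e, hBe t ω hω⟩,
        Set.indicator_of_mem (hBe t ω hω)]
    · rw [Set.indicator_of_notMem hω, Set.indicator_of_notMem hω]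
  filter_upwards [ae_mem_limsup_atTop_iff P hS, ae_all_iff.2 hcond] with ω hω hc hfreq
  have hterm : ∀ t, 0 ≤ (P[(S (t + 1)).indicator (1 : Ω → ℝ) | ℱ t]) ω := fun t => by
    rw [hc t]
    exact Set.indicator_nonneg (fun _ _ => by positivity) _
  -- On `B t` the conditional probability is at least `1 / |Sym2 V|`, so its terms do not tend to 0.
  have htend : Tendsto (fun n => ∑ k ∈ Finset.range n,
      (P[(S (k + 1)).indicator (1 : Ω → ℝ) | ℱ k]) ω) atTop atTop := by
    rw [← not_summable_iff_tendsto_nat_atTop_of_nonneg hterm]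
    intro hsum
    have hcard : (0 : ℝ) < (Nat.card (Sym2 V) : ℝ)⁻¹ := by
      have : Nonempty (Sym2 V) := ⟨e⟩
      have : 0 < Nat.card (Sym2 V) := Nat.card_pos
      positivity
    obtain ⟨t, hBt, hlt⟩ := (hfreq.and_eventually
      (hsum.tendsto_atTop_zero.eventually (gt_mem_nhds hcard))).exists
    rw [hc t, Set.indicator_of_mem hBt] at hlt
    refine hlt.not_ge (inv_anti₀ ?_ ?_)
    · exact_mod_cast (Set.ncard_pos (Set.toFinite _)).2 ⟨e, hBe t ω hBt⟩
    · exact_mod_cast Set.ncard_le_card _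
  have hmem := hω.2 htend
  rw [mem_limsup_iff_frequently_mem] at hmem
  rw [frequently_atTop] at hmem ⊢
  intro a
  obtain ⟨b, hab, hb⟩ := hmem (a + 1)
  obtain ⟨k, rfl⟩ : ∃ k, b = k + 1 := ⟨b - 1, by omega⟩
  exact ⟨k, by omega, hb.2, hb.1⟩

/-- Almost surely, from some time on every edge is short or incompatible. -/
theorem IsMixedModel.ae_edges_lt_or_lt [FiniteDimensional ℝ E] [IsProbabilityMeasure P]
    (h : IsMixedModel P ℱ G sel μ x₀) (hμ : ∀ᵐ ω ∂P, 0 < ⨅ t, μ t ω) (ε : ℝ) :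
    ∀ᵐ ω ∂P, ∀ δ : ℝ, 0 < δ → ∀ᶠ t in atTop, ∀ i j, (G t ω).Adj i j →
      ‖opinion ε (fun t => G t ω) (fun t => sel t ω) (fun t => μ t ω) (fun i => x₀ i ω) t i -
        opinion ε (fun t => G t ω) (fun t => sel t ω) (fun t => μ t ω) (fun i => x₀ i ω) t j‖ < δ ∨
      ε < ‖opinion ε (fun t => G t ω) (fun t => sel t ω) (fun t => μ t ω) (fun i => x₀ i ω) t i -
        opinion ε (fun t => G t ω) (fun t => sel t ω) (fun t => μ t ω) (fun i => x₀ i ω) t j‖ := by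
  have : ProperSpace E := FiniteDimensional.proper_real E
  set x : Ω → ℕ → V → E := fun ω => opinion ε (fun t => G t ω) (fun t => sel t ω)
    (fun t => μ t ω) (fun i => x₀ i ω) with hx
  -- Thresholds `1 / (m + 1)` leave only countably many null sets to discard.
  let B : V → V → ℕ → ℕ → Set Ω := fun i j m t => {ω | (G t ω).Adj i j} ∩
    {ω | ‖x ω t i - x ω t j‖ ∈ Set.Icc (1 / ((m : ℝ) + 1)) ε}
  have hB : ∀ i j m t, MeasurableSet[ℱ t] (B i j m t) := fun i j m t =>
    (h.measurable_graph t i j).inter (measurableSet_norm_sub_mem (h.measurable_opinion ε t i)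
      (h.measurable_opinion ε t j) measurableSet_Icc)
  have hfreq : ∀ᵐ ω ∂P, ∀ i j m, (∃ᶠ t in atTop, ω ∈ B i j m t) →
      ∃ᶠ t in atTop, sel t ω = s(i, j) ∧ ω ∈ B i j m t :=
    ae_all_iff.2 fun i => ae_all_iff.2 fun j => ae_all_iff.2 fun m =>
      h.ae_frequently_selected s(i, j) (hB i j m) fun t ω hω => hω.1
  filter_upwards [hfreq, hμ] with ω hω hpos δ hδ
  obtain ⟨m, hm⟩ := exists_nat_one_div_lt hδ
  refine eventually_all.2 fun i => eventually_all.2 fun j => ?_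
  have hnot : ¬ ∃ᶠ t in atTop, ω ∈ B i j m t := by
    intro hf
    obtain ⟨t, ⟨hsel, hadj, hge, hle⟩, ht⟩ := ((hω i j m hf).and_eventually
      (eventually_selected_lt (ε := ε) (G := fun t => G t ω) (sel := fun t => sel t ω)
        (x₀ := fun i => x₀ i ω) (fun t => h.rate_mem t ω) hpos
        (by positivity : 0 < 1 / ((m : ℝ) + 1)))).exists
    exact absurd (ht i j hsel hadj hle) (not_lt.2 hge)
  filter_upwards [not_frequently.1 hnot] with t ht hadj
  by_contra! hcon
  exact ht ⟨hadj, hm.le.trans hcon.1, hcon.2⟩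

end Random

/-! ### The probability bound. -/

theorem norm_sub_le_radiusAt {E : Type*} [NormedAddCommGroup E] {Δ : Set E}
    (hΔ : Bornology.IsBounded Δ) (c : E) {z : E} (hz : z ∈ Δ) : ‖z - c‖ ≤ radiusAt Δ c := by
  obtain ⟨R, hR⟩ := hΔ.subset_closedBall c
  -- Boundedness matters: an unbounded real supremum is 0 by convention.
  refine le_ciSup (f := fun z : Δ => ‖(z : E) - c‖) ⟨R, ?_⟩ ⟨z, hz⟩
  rintro _ ⟨y, rfl⟩
  simpa [dist_eq_norm] using hR y.2

theorem mainTheorem3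
    {E : Type*} [NormedAddCommGroup E] [NormedSpace ℝ E] [FiniteDimensional ℝ E]
    [MeasurableSpace E] [BorelSpace E]
    {V : Type*} [Fintype V] [Nonempty V]
    {Ω : Type*} {mΩ : MeasurableSpace Ω} (P : Measure Ω) [IsProbabilityMeasure P]
    {Ω' : Type*} {mΩ' : MeasurableSpace Ω'} (P' : Measure Ω') [IsProbabilityMeasure P']
    (ℱ : Filtration ℕ mΩ) (G : ℕ → Ω → SimpleGraph V) (sel : ℕ → Ω → Sym2 V)
    (μ : ℕ → Ω → ℝ) (x₀ : V → Ω → E)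
    (hmodel : IsMixedModel P ℱ G sel μ x₀)
    (Δ : Set E) (hΔb : Bornology.IsBounded Δ) (hΔc : Convex ℝ Δ)
    (hx₀Δ : ∀ i, ∀ᵐ ω ∂P, x₀ i ω ∈ Δ)
    (hindep : iIndepFun x₀ P)
    (X : Ω' → E) (hident : ∀ i, IdentDistrib (x₀ i) X P P')
    (c : E) (hc : IsChebyshevCenter Δ c)
    (hG : ∀ᵐ ω ∂P, ∃ᶠ t in atTop, (G t ω).Connected)
    (hμ : ∀ᵐ ω ∂P, 0 < ⨅ t, μ t ω)
    (ε : ℝ) (hε : radiusAt Δ c < ε) :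
    1 - (∫ ω, ‖X ω - c‖ ∂P') / (ε - radiusAt Δ c) ≤
        P.real {ω | IsConsensus
          (opinion ε (fun t => G t ω) (fun t => sel t ω) (fun t => μ t ω) (fun i => x₀ i ω))} ∧
      (Metric.diam Δ ≤ ε →
        P {ω | IsConsensus
          (opinion ε (fun t => G t ω) (fun t => sel t ω) (fun t => μ t ω) (fun i => x₀ i ω))} = 1) := by
  have : ProperSpace E := FiniteDimensional.proper_real E
  have hedge := hmodel.ae_edges_lt_or_lt hμ ε
  have hmem : ∀ᵐ ω ∂P, ∀ i, x₀ i ω ∈ Δ := ae_all_iff.2 hx₀Δ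
  have hrate : ∀ ω t, μ t ω ∈ Set.Icc (0 : ℝ) (1 / 2) := fun ω t => hmodel.rate_mem t ω
  refine ⟨?_, fun hdiam => ?_⟩
  · have hpos : 0 < ε - radiusAt Δ c := sub_pos.2 hε
    have hn : (0 : ℝ) < Fintype.card V := by exact_mod_cast Fintype.card_pos
    have hmeas : ∀ i, Measurable fun ω => ‖x₀ i ω - c‖ := fun i =>
      (((hmodel.measurable_init i).mono (ℱ.le 0) le_rfl).sub_const c).norm
    have hint : ∀ i, Integrable (fun ω => ‖x₀ i ω - c‖) P := fun i => by
      refine Integrable.of_bound (hmeas i).aestronglyMeasurable (radiusAt Δ c) ?_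
      filter_upwards [hx₀Δ i] with ω hω
      simpa using norm_sub_le_radiusAt hΔb c hω
    have hEX : ∀ i, ∫ ω, ‖x₀ i ω - c‖ ∂P = ∫ ω, ‖X ω - c‖ ∂P' := fun i =>
      ((hident i).comp (measurable_id.sub_const c).norm).integral_eq
    set Z : Ω → ℝ := fun ω => ∑ i, ‖x₀ i ω - c‖ with hZ
    have hZm : Measurable Z := Finset.measurable_sum _ fun i _ => hmeas i
    have hZint : ∫ ω, Z ω ∂P = Fintype.card V * ∫ ω, ‖X ω - c‖ ∂P' := by
      rw [hZ, integral_finsetSum _ fun i _ => hint i]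
      simp [hEX]
    set a : ℝ := Fintype.card V * (ε - radiusAt Δ c) with ha
    -- The number of agents cancels between the mean of `Z` and the threshold `a`.
    have hmarkov : P.real {ω | a ≤ Z ω} ≤ (∫ ω, ‖X ω - c‖ ∂P') / (ε - radiusAt Δ c) := by
      have := mul_meas_ge_le_integral_of_nonneg (μ := P) (f := Z)
        (Eventually.of_forall fun ω => Finset.sum_nonneg fun i _ => norm_nonneg _)
        (integrable_finsetSum _ fun i _ => hint i) a
      rw [hZint, ha, mul_assoc] at this
      rw [le_div_iff₀ hpos, mul_comm]
      exact le_of_mul_le_mul_left this hn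
    have hcompl : P.real {ω | a ≤ Z ω}ᶜ = 1 - P.real {ω | a ≤ Z ω} :=
      probReal_compl_eq_one_sub (measurableSet_le measurable_const hZm)
    refine (by linarith : _ ≤ P.real {ω | a ≤ Z ω}ᶜ).trans ?_
    -- An almost sure inclusion needs no measurability of the consensus event.
    refine ENNReal.toReal_mono (measure_ne_top _ _) (measure_mono_ae ?_)
    filter_upwards [hedge, hmem, hG] with ω h1 h2 h3 h4
    exact isConsensus_of_sum_lt (hrate ω) h3 h1 (fun i => norm_sub_le_radiusAt hΔb c (h2 i))
      (not_le.1 h4)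
  · rw [← measure_univ (μ := P)]
    refine measure_congr (eventuallyEq_univ.2 ?_)
    filter_upwards [hedge, hmem, hG] with ω h1 h2 h3
    refine isConsensus_of_forall_le (hrate ω) h3 h1 fun i j => ?_
    rw [← dist_eq_norm]
    exact (Metric.dist_le_diam_of_mem hΔb (h2 i) (h2 j)).trans hdiam
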